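/- Let $(W,S)$ be a Coxeter system with $W$ finite, and let $T=\bigcup_{u\in W}uSu^{-1}$ be its set of reflections. Let $W'\subseteq W$ be a reflection subgroup, that is, a subgroup generated by a subset of $T$, and put $T'=W'\cap T$. For $X\in\{T,T'\}$ and an element $w$ of the subgroup generated by $X$, let $\ell_X(w)$ denote the smallest $n\ge 0$ such that $w$ is a product of $n$ elements of $X$. Then for every $w\in W'$ one has $$\ell_T(w)=\ell_{T'}(w).$$ -/

import Mathlib

/-- The length of `w` with respect to a subset `X` of a group: the smallest `n` such that `w` is a
product of `n` elements of `X`. It is meant for `w` that are such a product; for the sets of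
reflections used below this is proved in `exists_list_of_mem_reflectionSubgroup`. -/
noncomputable def lengthWrt {G : Type*} [Group G] (X : Set G) (w : G) : ℕ :=
  sInf {n : ℕ | ∃ l : List G, (∀ t ∈ l, t ∈ X) ∧ l.prod = w ∧ l.length = n}

namespace CoxeterSystem

/-- The set `T` of reflections of a Coxeter system: the conjugates of the simple reflections. -/
def reflections {B W : Type*} [Group W] {M : CoxeterMatrix B} (cs : CoxeterSystem M W) : Set W :=
  {t : W | cs.IsReflection t}

/-- A reflection subgroup is a subgroup generated by a set of reflections. -/
def IsReflectionSubgroup {B W : Type*} [Group W] {M : CoxeterMatrix B} (cs : CoxeterSystem M W)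
    (W' : Subgroup W) : Prop :=
  ∃ X : Set W, X ⊆ cs.reflections ∧ W' = Subgroup.closure X

open scoped Pointwise in
/-- Every element of a reflection subgroup `W'` is a product of elements of `W' ∩ T`, so the minimum
in `lengthWrt` is over a nonempty set. -/
theorem exists_list_of_mem_reflectionSubgroup {B W : Type*} [Group W] {M : CoxeterMatrix B}
    (cs : CoxeterSystem M W) {W' : Subgroup W} (hW' : cs.IsReflectionSubgroup W') {w : W}
    (hw : w ∈ W') :
    ∃ l : List W, (∀ t ∈ l, t ∈ (W' : Set W) ∩ cs.reflections) ∧ l.prod = w := by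
  obtain ⟨X, hX, rfl⟩ := hW'
  obtain ⟨l, hl, hp⟩ := Submonoid.exists_list_of_mem_closure (s := X ∪ X⁻¹)
    (by rwa [← Subgroup.closure_toSubmonoid])
  refine ⟨l, fun t ht => ?_, hp⟩
  rcases hl t ht with h | h
  · exact ⟨Subgroup.subset_closure h, hX h⟩
  · replace h : t⁻¹ ∈ X := h
    have h2 : t⁻¹ = t := by
      have h3 := IsReflection.inv (hX h)
      rw [inv_inv] at h3
      exact h3.symm
    rw [h2] at h
    exact ⟨Subgroup.subset_closure h, hX h⟩

/-- The whole group is a reflection subgroup. -/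
theorem isReflectionSubgroup_top {B W : Type*} [Group W] {M : CoxeterMatrix B}
    (cs : CoxeterSystem M W) : cs.IsReflectionSubgroup ⊤ :=
  ⟨Set.range cs.simple, by rintro _ ⟨i, rfl⟩; exact cs.isReflection_simple i,
    cs.subgroup_closure_range_simple.symm⟩

end CoxeterSystem

/-! Both lengths equal the codimension of the fixed space of `w` in one faithful orthogonal
representation (Carter's lemma), and that number does not see which reflection group `w` is placed
in. The representation is the geometric one, faithful by positivity of roots
(`geomRep_single_nonneg`). As `W` is finite, averaging makes it orthogonal, and reflections of `W`
act as hyperplane reflections.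

A product of `n` reflections fixes a space of codimension at most `n`
(`codim_fixedSpace_prod_le_length`). Conversely, in a finite group generated by reflections, each `g
≠ 1` has a reflection `t` whose hyperplane contains the fixed space of `g`, and then `t * g` fixes
strictly more; induction gives the upper bound. Such a `t` exists because the group acts freely on
points off all hyperplanes (`eq_one_of_map_eq_self`). The lower bound is applied in `W`, the upper
bound in `W'`. -/

namespace CoxeterMatrix

/-! ### Dihedral computations and the braid relations. -/

variable {B : Type*} (M : CoxeterMatrix B)

/-- The functional `2 (α i, ·)`, where `(·, ·)` is the canonical bilinear form on `B →₀ ℝ`. -/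
noncomputable def geomCoroot (i : B) : (B →₀ ℝ) →ₗ[ℝ] ℝ :=
  Finsupp.linearCombination ℝ fun j => -2 * Real.cos (Real.pi / M i j)

@[simp]
theorem geomCoroot_single (i j : B) (c : ℝ) :
    M.geomCoroot i (Finsupp.single j c) = c * (-2 * Real.cos (Real.pi / M i j)) := by
  simp [geomCoroot]

theorem geomCoroot_single_self (i : B) (c : ℝ) :
    M.geomCoroot i (Finsupp.single i c) = 2 * c := by
  simp [mul_comm]

/-- The reflection attached to a simple root. -/
noncomputable def geomReflection (i : B) : Module.End ℝ (B →₀ ℝ) :=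
  LinearMap.id - (M.geomCoroot i).smulRight (Finsupp.single i 1)

theorem geomReflection_apply (i : B) (x : B →₀ ℝ) :
    M.geomReflection i x = x - M.geomCoroot i x • Finsupp.single i 1 := by
  simp [geomReflection]

theorem geomReflection_mul_self (i : B) : M.geomReflection i * M.geomReflection i = 1 := by
  refine LinearMap.ext fun x => ?_
  simp only [Module.End.mul_apply, geomReflection_apply, map_sub, map_smul,
    geomCoroot_single_self, Module.End.one_apply]
  module

/-- The coefficients of the roots in a dihedral subsystem: `geomCoeff θ k = sin (k θ) / sin θ`. -/
noncomputable def geomCoeff (θ : ℝ) : ℕ → ℝ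
  | 0 => 0
  | 1 => 1
  | k + 2 => 2 * Real.cos θ * geomCoeff θ (k + 1) - geomCoeff θ k

theorem geomCoeff_mul_sin (θ : ℝ) (k : ℕ) :
    geomCoeff θ k * Real.sin θ = Real.sin (k * θ) := by
  induction k using Nat.twoStepInduction with
  | zero => simp [geomCoeff]
  | one => simp [geomCoeff]
  | more k h0 h1 =>
    have e2 : ((k + 2 : ℕ) : ℝ) * θ = (k + 1 : ℕ) * θ + θ := by push_cast; ring
    have e0 : (k : ℝ) * θ = (k + 1 : ℕ) * θ - θ := by push_cast; ring
    rw [geomCoeff, sub_mul, mul_assoc, h1, h0, e2, e0, Real.sin_add, Real.sin_sub]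
    ring

theorem geomCoeff_zero_angle (k : ℕ) : geomCoeff 0 k = k := by
  induction k using Nat.twoStepInduction with
  | zero => simp [geomCoeff]
  | one => simp [geomCoeff]
  | more k h0 h1 =>
    rw [geomCoeff, h1, h0, Real.cos_zero]
    push_cast
    ring

theorem sin_pi_div_pos {m : ℕ} (hm : 2 ≤ m) : 0 < Real.sin (Real.pi / m) := by
  have h : (2 : ℝ) ≤ m := by exact_mod_cast hm
  apply Real.sin_pos_of_pos_of_lt_pi (by positivity)
  rw [div_lt_iff₀ (by linarith)]
  nlinarith [Real.pi_pos]

/-- For `k ≤ m` the angle `k * π / m` stays in `[0, π]`. Infinite order is encoded by `m = 0`, where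
`π / 0 = 0` and the coefficient is `k` itself. -/
theorem geomCoeff_nonneg {m k : ℕ} (hm1 : m ≠ 1) (hk : m = 0 ∨ k ≤ m) :
    0 ≤ geomCoeff (Real.pi / m) k := by
  rcases Nat.eq_zero_or_pos m with rfl | hm
  · simp [geomCoeff_zero_angle]
  · have hs := sin_pi_div_pos (m := m) (by omega)
    refine nonneg_of_mul_nonneg_left ?_ hs
    rw [geomCoeff_mul_sin]
    have hk' : (k : ℝ) ≤ m := by exact_mod_cast (hk.resolve_left hm.ne')
    have hm' : (0 : ℝ) < m := by exact_mod_cast hm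
    apply Real.sin_nonneg_of_nonneg_of_le_pi (by positivity)
    calc (k : ℝ) * (Real.pi / m) ≤ m * (Real.pi / m) := by gcongr
      _ = Real.pi := by field_simp

theorem geomReflection_comb_left (i j : B) (a b : ℝ) :
    M.geomReflection i (Finsupp.single i a + Finsupp.single j b) =
      Finsupp.single i (2 * Real.cos (Real.pi / M i j) * b - a) + Finsupp.single j b := by
  rw [geomReflection_apply, map_add, geomCoroot_single_self, geomCoroot_single, Finsupp.smul_single,
    add_sub_right_comm, ← Finsupp.single_sub]
  congr 2
  simp
  ring

theorem geomReflection_comb_right (i j : B) (a b : ℝ) :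
    M.geomReflection j (Finsupp.single i a + Finsupp.single j b) =
      Finsupp.single i a + Finsupp.single j (2 * Real.cos (Real.pi / M i j) * a - b) := by
  rw [add_comm, geomReflection_comb_left, add_comm, M.symmetric j i]

theorem geomReflection_mul_pow_single (i j : B) (k : ℕ) :
    ((M.geomReflection i * M.geomReflection j) ^ k) (Finsupp.single i 1) =
      Finsupp.single i (geomCoeff (Real.pi / M i j) (2 * k + 1)) +
        Finsupp.single j (geomCoeff (Real.pi / M i j) (2 * k)) := by
  induction k with
  | zero => simp [geomCoeff]
  | succ k ih =>
    rw [pow_succ', Module.End.mul_apply, ih, Module.End.mul_apply, geomReflection_comb_right,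
      geomReflection_comb_left]
    rfl

theorem geomReflection_mul_pow_single_eq (i j : B) (hm : 2 ≤ M i j) :
    ((M.geomReflection i * M.geomReflection j) ^ M i j) (Finsupp.single i 1) =
      Finsupp.single i 1 := by
  have hs := (sin_pi_div_pos hm).ne'
  have hm0 : (M i j : ℝ) ≠ 0 := by positivity
  have e0 : geomCoeff (Real.pi / M i j) (2 * M i j) = 0 := by
    apply mul_right_cancel₀ hs
    rw [geomCoeff_mul_sin]
    have : ((2 * M i j : ℕ) : ℝ) * (Real.pi / M i j) = 2 * Real.pi := by
      push_cast; field_simp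
    rw [this, Real.sin_two_pi, zero_mul]
  have e1 : geomCoeff (Real.pi / M i j) (2 * M i j + 1) = 1 := by
    apply mul_right_cancel₀ hs
    rw [geomCoeff_mul_sin]
    have : ((2 * M i j + 1 : ℕ) : ℝ) * (Real.pi / M i j) = Real.pi / M i j + 2 * Real.pi := by
      push_cast; field_simp; ring
    rw [this, Real.sin_add_two_pi, one_mul]
  rw [geomReflection_mul_pow_single, e0, e1]
  simp

theorem mul_pow_mul_pow_of_involutive {G : Type*} [Monoid G] {a b : G} (ha : a * a = 1)
    (hb : b * b = 1) (k : ℕ) : (a * b) ^ k * (b * a) ^ k = 1 := by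
  induction k with
  | zero => simp
  | succ k ih =>
    rw [pow_succ, pow_succ' (b * a)]
    calc (a * b) ^ k * (a * b) * (b * a * (b * a) ^ k)
        = (a * b) ^ k * (a * (b * b) * a) * (b * a) ^ k := by simp only [mul_assoc]
      _ = 1 := by rw [hb, mul_one, ha, mul_one, ih]

/-- The power of the product fixes both simple roots and the common kernel of both coroots. These
span the space because the dihedral Gram determinant is a multiple of `sin² (π / m) ≠ 0`. -/
theorem geomReflection_isLiftable : M.IsLiftable M.geomReflection := by
  intro i j
  rcases Nat.eq_zero_or_pos (M i j) with h0 | h0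
  · rw [h0, pow_zero]
  by_cases hij : i = j
  · subst hij
    rw [M.diagonal, pow_one, geomReflection_mul_self]
  have hm : 2 ≤ M i j := by
    have := M.off_diagonal i j hij
    omega
  set R := M.geomReflection i * M.geomReflection j with hR
  have hi : (R ^ M i j) (Finsupp.single i 1) = Finsupp.single i 1 :=
    M.geomReflection_mul_pow_single_eq i j hm
  have hj : (R ^ M i j) (Finsupp.single j 1) = Finsupp.single j 1 := by
    have h := M.geomReflection_mul_pow_single_eq j i (by rwa [M.symmetric])
    rw [M.symmetric j i] at h
    have h2 := mul_pow_mul_pow_of_involutive (M.geomReflection_mul_self i)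
      (M.geomReflection_mul_self j) (M i j)
    conv_lhs => rw [← h]
    rw [← Module.End.mul_apply, h2, Module.End.one_apply]
  have hfix : ∀ x, M.geomCoroot i x = 0 → M.geomCoroot j x = 0 → (R ^ M i j) x = x := by
    intro x hxi hxj
    have : R x = x := by
      simp [hR, geomReflection_apply, hxi, hxj]
    generalize M i j = k
    induction k with
    | zero => simp
    | succ k ih => rw [pow_succ, Module.End.mul_apply, this, ih]
  refine LinearMap.ext fun x => ?_
  set c := Real.cos (Real.pi / M i j) with hc
  set s := Real.sin (Real.pi / M i j) with hs
  have hs0 : s ≠ 0 := (sin_pi_div_pos hm).ne'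
  have hcs : c ^ 2 = 1 - s ^ 2 := by
    have := Real.sin_sq_add_cos_sq (Real.pi / M i j)
    linarith
  set p := M.geomCoroot i x
  set q := M.geomCoroot j x
  -- Solution of the 2×2 system that makes both coroots vanish on `x` minus this combination.
  set a := (p + c * q) / (2 * s ^ 2)
  set b := (q + c * p) / (2 * s ^ 2)
  have hij1 : M.geomCoroot i (Finsupp.single j 1) = -2 * c := by simp [hc]
  have hji1 : M.geomCoroot j (Finsupp.single i 1) = -2 * c := by simp [hc, M.symmetric j i]
  have hy := hfix (x - a • Finsupp.single i 1 - b • Finsupp.single j 1)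
    (by
      rw [map_sub, map_sub, map_smul, map_smul, geomCoroot_single_self, hij1]
      change p - _ - _ = 0
      simp only [a, b, smul_eq_mul]
      field_simp
      linear_combination p * hcs)
    (by
      rw [map_sub, map_sub, map_smul, map_smul, geomCoroot_single_self, hji1]
      change q - _ - _ = 0
      simp only [a, b, smul_eq_mul]
      field_simp
      linear_combination q * hcs)
  rw [map_sub, map_sub, map_smul, map_smul, hi, hj] at hy
  rw [Module.End.one_apply]
  simpa using hy

end CoxeterMatrix

/-! ### Positivity of roots and faithfulness. -/

namespace CoxeterSystem

variable {B W : Type*} [Group W] {M : CoxeterMatrix B} (cs : CoxeterSystem M W)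

/-- The geometric representation of a Coxeter group. -/
noncomputable def geomRep : W →* Module.End ℝ (B →₀ ℝ) :=
  cs.lift ⟨M.geomReflection, M.geomReflection_isLiftable⟩

theorem geomRep_simple (i : B) : cs.geomRep (cs.simple i) = M.geomReflection i :=
  cs.lift_apply_simple _ i

theorem geomRep_simple_single_self (i : B) (c : ℝ) :
    cs.geomRep (cs.simple i) (Finsupp.single i c) = - Finsupp.single i c := by
  rw [geomRep_simple, M.geomReflection_apply, M.geomCoroot_single_self, Finsupp.smul_single,
    ← Finsupp.single_sub, ← Finsupp.single_neg]
  congr 1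
  simp
  ring

theorem simple_injective : Function.Injective cs.simple := by
  intro i j h
  by_contra hij
  have h1 := cs.geomRep_simple_single_self i 1
  rw [h, geomRep_simple, M.geomReflection_apply] at h1
  have h2 := DFunLike.congr_fun h1 i
  simp [Finsupp.single_eq_of_ne hij] at h2
  norm_num at h2

theorem geomRep_alternatingWord_single (i j : B) (k : ℕ) :
    cs.geomRep (cs.wordProd (alternatingWord i j k)) (Finsupp.single i 1) =
      if Even k then
        Finsupp.single i (CoxeterMatrix.geomCoeff (Real.pi / M i j) (k + 1)) +
          Finsupp.single j (CoxeterMatrix.geomCoeff (Real.pi / M i j) k)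
      else
        Finsupp.single i (CoxeterMatrix.geomCoeff (Real.pi / M i j) k) +
          Finsupp.single j (CoxeterMatrix.geomCoeff (Real.pi / M i j) (k + 1)) := by
  induction k with
  | zero => simp [alternatingWord, CoxeterMatrix.geomCoeff]
  | succ k ih =>
    rw [alternatingWord_succ', cs.wordProd_cons, map_mul, Module.End.mul_apply, ih, geomRep_simple]
    by_cases hk : Even k
    · have hk' : ¬ Even (k + 1) := by simpa [Nat.even_add_one] using hk
      rw [if_pos hk, if_pos hk, if_neg hk', M.geomReflection_comb_right]
      rfl
    · have hk' : Even (k + 1) := by simpa [Nat.even_add_one] using hk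
      rw [if_neg hk, if_neg hk, if_pos hk', M.geomReflection_comb_left]
      rfl

theorem alternatingWord_eq_append (i j : B) (k : ℕ) :
    ∀ m ≤ k, ∃ ω : List B, ω.length = k - m ∧ alternatingWord i j k = ω ++ alternatingWord i j m := by
  induction k with
  | zero =>
    intro m hm
    obtain rfl : m = 0 := by omega
    exact ⟨[], rfl, rfl⟩
  | succ k ih =>
    intro m hm
    rcases Nat.lt_or_ge k m with h | h
    · obtain rfl : m = k + 1 := by omega
      exact ⟨[], by simp, rfl⟩
    · obtain ⟨ω, h1, h2⟩ := ih m h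
      rw [alternatingWord_succ', h2]
      exact ⟨_ :: ω, by simp [h1]; omega, rfl⟩

/-- A simple root is sent to a nonnegative combination of simple roots by every element of which
the corresponding simple reflection is not a right descent. -/
theorem geomRep_single_nonneg (w : W) (i : B) (hw : ¬ cs.IsRightDescent w i) :
    0 ≤ cs.geomRep w (Finsupp.single i 1) := by
  induction hn : cs.length w using Nat.strong_induction_on generalizing w i with
  | _ n IH =>
  subst hn
  by_cases hw1 : w = 1
  · subst hw1
    simp
  obtain ⟨j, hj⟩ := cs.exists_rightDescent_of_ne_one hw1
  have hij : i ≠ j := by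
    rintro rfl
    exact hw hj
  -- Split off an alternating suffix in `i`, `j` with additive lengths, as long as possible.
  set P : ℕ → Prop := fun k => ∃ v : W, w = v * cs.wordProd (alternatingWord i j k) ∧
    cs.length w = cs.length v + k with hP
  have hP1 : P 1 := by
    refine ⟨w * cs.simple j, ?_, ?_⟩
    · simp [alternatingWord]
    · rw [cs.isRightDescent_iff] at hj
      omega
  have hbdd : ∀ k, P k → k ≤ cs.length w := by
    rintro k ⟨v, -, h⟩
    omega
  classical
  set k := Nat.findGreatest P (cs.length w)
  have hk1 : 1 ≤ k := Nat.le_findGreatest (hbdd 1 hP1) hP1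
  have hmax : ¬ P (k + 1) := fun h => by
    have := Nat.le_findGreatest (hbdd _ h) h
    change k + 1 ≤ k at this
    omega
  obtain ⟨v, hv, hlen⟩ : P k := Nat.findGreatest_spec (hbdd 1 hP1) hP1
  have hmm : M i j ≠ 1 := M.off_diagonal i j hij
  -- A suffix of length at least `M i j` could be rewritten by the braid relation to end in `i`,
  -- making `i` a right descent of `w`.
  have hkm : M i j = 0 ∨ k + 1 ≤ M i j := by
    by_contra! hcon
    obtain ⟨h0, h1⟩ := hcon
    obtain ⟨m, hm⟩ := Nat.exists_eq_succ_of_ne_zero h0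
    obtain ⟨ω, hω, hω'⟩ := alternatingWord_eq_append i j k (M i j) (by omega)
    apply hw
    have hb := cs.wordProd_braidWord_eq i j
    unfold braidWord at hb
    rw [M.symmetric j i] at hb
    have hws : w * cs.simple i = v * cs.wordProd ω * cs.wordProd (alternatingWord i j m) := by
      rw [hv, hω', cs.wordProd_append, hb, hm, alternatingWord_succ, cs.wordProd_concat]
      simp [mul_assoc]
    have l1 := cs.length_mul_le (v * cs.wordProd ω) (cs.wordProd (alternatingWord i j m))
    have l2 := cs.length_mul_le v (cs.wordProd ω)
    have l3 := cs.length_wordProd_le ω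
    have l4 := cs.length_wordProd_le (alternatingWord i j m)
    rw [length_alternatingWord] at l4
    unfold IsRightDescent
    rw [hws]
    omega
  -- A descent at the suffix's first letter would contradict additivity of lengths; a descent at the
  -- other letter would lengthen the suffix.
  have hdesc : ∀ x, (x = if Even k then i else j) ∨ (x = if Even k then j else i) →
      ¬ cs.IsRightDescent v x := by
    rintro x (hx | hx) hd
    · obtain ⟨p, hp⟩ := Nat.exists_eq_add_of_le' hk1
      have hx' : x = if Even p then j else i := by
        rw [hx, hp]
        by_cases h : Even p <;> simp [Nat.even_add_one, h]
      have hw' : w = v * cs.simple x * cs.wordProd (alternatingWord i j p) := by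
        rw [hv, hp, alternatingWord_succ', cs.wordProd_cons, ← hx', mul_assoc]
      have l1 := cs.length_mul_le (v * cs.simple x) (cs.wordProd (alternatingWord i j p))
      have l2 := cs.length_wordProd_le (alternatingWord i j p)
      rw [length_alternatingWord] at l2
      rw [cs.isRightDescent_iff] at hd
      rw [← hw'] at l1
      omega
    · apply hmax
      refine ⟨v * cs.simple x, ?_, ?_⟩
      · rw [alternatingWord_succ', cs.wordProd_cons, ← hx, hv]
        simp [mul_assoc]
      · rw [cs.isRightDescent_iff] at hd
        omega
  have hdi : ¬ cs.IsRightDescent v i := hdesc i (by by_cases h : Even k <;> simp [h])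
  have hdj : ¬ cs.IsRightDescent v j := hdesc j (by by_cases h : Even k <;> simp [h])
  have hi := IH (cs.length v) (by omega) v i hdi rfl
  have hj := IH (cs.length v) (by omega) v j hdj rfl
  have ha : 0 ≤ CoxeterMatrix.geomCoeff (Real.pi / M i j) k :=
    CoxeterMatrix.geomCoeff_nonneg hmm (by omega)
  have hb : 0 ≤ CoxeterMatrix.geomCoeff (Real.pi / M i j) (k + 1) :=
    CoxeterMatrix.geomCoeff_nonneg hmm hkm
  have key : ∀ a b : ℝ, 0 ≤ a → 0 ≤ b →
      0 ≤ cs.geomRep v (Finsupp.single i a + Finsupp.single j b) := by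
    intro a b ha hb
    have : Finsupp.single i a + Finsupp.single j b =
        a • Finsupp.single i (1 : ℝ) + b • Finsupp.single j (1 : ℝ) := by simp
    rw [this, map_add, map_smul, map_smul]
    exact add_nonneg (smul_nonneg ha hi) (smul_nonneg hb hj)
  rw [hv, map_mul, Module.End.mul_apply, geomRep_alternatingWord_single]
  split_ifs
  · exact key _ _ hb ha
  · exact key _ _ ha hb

theorem geomRep_injective : Function.Injective cs.geomRep := by
  rw [injective_iff_map_eq_one]
  intro w hw
  by_contra hne
  obtain ⟨i, hi⟩ := cs.exists_rightDescent_of_ne_one hne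
  have h := cs.geomRep_single_nonneg (w * cs.simple i) i
    (cs.isRightDescent_iff_not_isRightDescent_mul.1 hi)
  rw [map_mul, hw, one_mul, geomRep_simple_single_self] at h
  have := h i
  simp at this
  norm_num at this

end CoxeterSystem

/-! ### The exchange argument for an abstract reflection cocycle. -/

section Cocycle

variable {G : Type*} [Group G] {N : G → Set G} {D : Set G}

theorem exists_erase_of_mem_cocycle (h1 : N 1 = ∅)
    (hmul : ∀ g h t, t ∈ N (g * h) ↔ (t ∈ N g ↔ g⁻¹ * t * g ∉ N h))
    (hD : ∀ s ∈ D, N s = {s} ∧ s * s = 1) (l : List G) (hl : ∀ s ∈ l, s ∈ D) (t : G)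
    (ht : t ∈ N l.prod) :
    ∃ l' : List G, (∀ s ∈ l', s ∈ D) ∧ l'.length + 1 = l.length ∧ t * l.prod = l'.prod := by
  induction l generalizing t with
  | nil => simp [h1] at ht
  | cons r l ih =>
    obtain ⟨hr, hl'⟩ := List.forall_mem_cons.1 hl
    obtain ⟨hNr, hrr⟩ := hD r hr
    rw [List.prod_cons, hmul, hNr, Set.mem_singleton_iff] at ht
    by_cases htr : t = r
    · subst htr
      exact ⟨l, hl', rfl, by rw [List.prod_cons, ← mul_assoc, hrr, one_mul]⟩
    · obtain ⟨l', h2, h3, h4⟩ := ih hl' (r⁻¹ * t * r) (by tauto)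
      refine ⟨r :: l', List.forall_mem_cons.2 ⟨hr, h2⟩, by simpa using h3, ?_⟩
      rw [List.prod_cons, List.prod_cons, ← h4]
      group

/-- If `r` is the first letter, emptiness puts `r` in the set of the remaining word, so exchange
there removes two letters in all. -/
theorem prod_eq_one_of_cocycle_eq_empty (h1 : N 1 = ∅)
    (hmul : ∀ g h t, t ∈ N (g * h) ↔ (t ∈ N g ↔ g⁻¹ * t * g ∉ N h))
    (hD : ∀ s ∈ D, N s = {s} ∧ s * s = 1) (l : List G) (hl : ∀ s ∈ l, s ∈ D)
    (hN : N l.prod = ∅) : l.prod = 1 := by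
  induction hn : l.length using Nat.strong_induction_on generalizing l with
  | _ n IH =>
  subst hn
  cases l with
  | nil => rfl
  | cons r l =>
    obtain ⟨hr, hl⟩ := List.forall_mem_cons.1 hl
    have hrN : r ∉ N (r * l.prod) := by
      rw [← List.prod_cons, hN]
      exact Set.notMem_empty r
    rw [hmul, (hD r hr).1, inv_mul_cancel, one_mul] at hrN
    obtain ⟨l', h2, h3, h4⟩ := exists_erase_of_mem_cocycle h1 hmul hD l hl r
      (by simpa using hrN)
    rw [List.prod_cons] at hN ⊢
    rw [h4] at hN ⊢
    exact IH l'.length (by simp; omega) l' h2 hN rfl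

theorem eq_one_of_cocycle_eq_empty (h1 : N 1 = ∅)
    (hmul : ∀ g h t, t ∈ N (g * h) ↔ (t ∈ N g ↔ g⁻¹ * t * g ∉ N h))
    (hD : ∀ s ∈ D, N s = {s} ∧ s * s = 1) {g : G} (hg : g ∈ Subgroup.closure D)
    (hN : N g = ∅) : g = 1 := by
  have hinv : D ∪ D⁻¹ = D := by
    refine Set.union_eq_self_of_subset_right fun s hs => ?_
    have := eq_inv_of_mul_eq_one_left (hD _ (Set.mem_inv.1 hs)).2
    rw [inv_inv] at this
    rw [← this]
    exact hs
  rw [← Subgroup.mem_toSubmonoid, Subgroup.closure_toSubmonoid, hinv] at hg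
  obtain ⟨l, hl, rfl⟩ := Submonoid.exists_list_of_mem_closure hg
  exact prod_eq_one_of_cocycle_eq_empty h1 hmul hD l hl hN

end Cocycle

/-! ### Orthogonal reflections, chambers and walls. -/

section Euclidean

open scoped RealInnerProductSpace

variable {V : Type*} [NormedAddCommGroup V] [InnerProductSpace ℝ V]

/-- `f` is the orthogonal reflection in the hyperplane orthogonal to the unit vector `a`. -/
def IsReflectionAlong (f : Module.End ℝ V) (a : V) : Prop :=
  ‖a‖ = 1 ∧ ∀ x, f x = x - (2 * ⟪a, x⟫) • a

namespace IsReflectionAlong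

variable {f f' : Module.End ℝ V} {a b : V}

theorem inner_self (h : IsReflectionAlong f a) : ⟪a, a⟫ = 1 := by
  rw [real_inner_self_eq_norm_sq, h.1, one_pow]

theorem neg (h : IsReflectionAlong f a) : IsReflectionAlong f (-a) := by
  refine ⟨by rw [norm_neg, h.1], fun x => ?_⟩
  rw [h.2 x, inner_neg_left]
  module

theorem apply_self (h : IsReflectionAlong f a) : f a = -a := by
  rw [h.2, h.inner_self]
  module

theorem apply_eq_self_iff (h : IsReflectionAlong f a) {x : V} : f x = x ↔ ⟪a, x⟫ = 0 := by
  have ha : a ≠ 0 := fun h0 => by simpa [h0] using h.1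
  rw [h.2, sub_eq_self, smul_eq_zero]
  simp [ha]

theorem mul_self (h : IsReflectionAlong f a) : f * f = 1 := by
  refine LinearMap.ext fun x => ?_
  rw [Module.End.mul_apply, h.2 x, map_sub, map_smul, h.apply_self, h.2 x, Module.End.one_apply]
  module

theorem eq_of_eq (h : IsReflectionAlong f a) (h' : IsReflectionAlong f' a) : f = f' :=
  LinearMap.ext fun x => by rw [h.2, h'.2]

theorem eq_or_eq_neg (h : IsReflectionAlong f a) (h' : IsReflectionAlong f b) :
    a = b ∨ a = -b := by
  have h1 : a = ⟪b, a⟫ • b := by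
    have h2 : -a = a - (2 * ⟪b, a⟫) • b := by rw [← h.apply_self, h'.2]
    have h3 : (2 : ℝ) • a = (2 : ℝ) • (⟪b, a⟫ • b) := by
      rw [smul_smul, two_smul]
      nth_rewrite 1 [← neg_neg a]
      rw [h2]
      module
    exact smul_right_injective V (two_ne_zero (α := ℝ)) h3
  have h4 : |⟪b, a⟫| = 1 := by
    have := congrArg norm h1
    rwa [norm_smul, h.1, h'.1, mul_one, eq_comm, Real.norm_eq_abs] at this
  rcases eq_or_eq_neg_of_abs_eq h4 with h5 | h5
  · left
    rw [h1, h5, one_smul]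
  · right
    rw [h1, h5, neg_smul, one_smul]

end IsReflectionAlong

variable {G : Type*} [Group G] {ρ : G →* Module.End ℝ V} {R : Set G} {a : G → V}

theorem inner_map_left_eq (hiso : ∀ g x y, ⟪ρ g x, ρ g y⟫ = ⟪x, y⟫) (g : G) (x y : V) :
    ⟪x, ρ g y⟫ = ⟪ρ g⁻¹ x, y⟫ := by
  rw [← hiso g (ρ g⁻¹ x), ← Module.End.mul_apply, ← map_mul, mul_inv_cancel, map_one,
    Module.End.one_apply]

theorem IsReflectionAlong.conj (hiso : ∀ g x y, ⟪ρ g x, ρ g y⟫ = ⟪x, y⟫) {t : G} {b : V}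
    (h : IsReflectionAlong (ρ t) b) (g : G) :
    IsReflectionAlong (ρ (g * t * g⁻¹)) (ρ g b) := by
  refine ⟨?_, fun x => ?_⟩
  · rw [← h.1, norm_eq_sqrt_real_inner, norm_eq_sqrt_real_inner, hiso]
  · have hg : ρ g (ρ g⁻¹ x) = x := by
      rw [← Module.End.mul_apply, ← map_mul, mul_inv_cancel, map_one, Module.End.one_apply]
    rw [map_mul, map_mul, Module.End.mul_apply, Module.End.mul_apply, h.2, map_sub, map_smul, hg,
      inner_map_left_eq hiso g⁻¹ b, inv_inv]

theorem map_root_eq_or_eq_neg (hiso : ∀ g x y, ⟪ρ g x, ρ g y⟫ = ⟪x, y⟫)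
    (hconj : ∀ g, ∀ t ∈ R, g * t * g⁻¹ ∈ R) (ha : ∀ t ∈ R, IsReflectionAlong (ρ t) (a t))
    (g : G) {t : G} (ht : t ∈ R) :
    ρ g (a t) = a (g * t * g⁻¹) ∨ ρ g (a t) = - a (g * t * g⁻¹) :=
  ((ha t ht).conj hiso g).eq_or_eq_neg (ha _ (hconj g t ht))

/-- The reflections in `R` whose hyperplane separates `v` from its image under `g`. -/
def separating (ρ : G →* Module.End ℝ V) (R : Set G) (a : G → V) (v : V) (g : G) : Set G :=
  {t ∈ R | ⟪a t, ρ g v⟫ < 0}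

/-- A hyperplane separates `v` from `ghv` exactly when it separates just one of the pairs `v, gv`
and `gv, ghv`; applying `g⁻¹` turns the second pair into `v, hv`. -/
theorem separating_mul (hiso : ∀ g x y, ⟪ρ g x, ρ g y⟫ = ⟪x, y⟫)
    (hconj : ∀ g, ∀ t ∈ R, g * t * g⁻¹ ∈ R) (ha : ∀ t ∈ R, IsReflectionAlong (ρ t) (a t))
    {v : V} (hv : ∀ t ∈ R, 0 < ⟪a t, v⟫) (g h t : G) :
    t ∈ separating ρ R a v (g * h) ↔
      (t ∈ separating ρ R a v g ↔ g⁻¹ * t * g ∉ separating ρ R a v h) := by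
  by_cases ht : t ∈ R
  · have ht' : g⁻¹ * t * g ∈ R := by simpa using hconj g⁻¹ t ht
    have hne : ⟪a (g⁻¹ * t * g), ρ h v⟫ ≠ 0 := by
      rw [inner_map_left_eq hiso]
      rcases map_root_eq_or_eq_neg hiso hconj ha h⁻¹ ht' with h1 | h1 <;> rw [h1]
      · exact (hv _ (hconj _ _ ht')).ne'
      · rw [inner_neg_left]
        exact (neg_neg_of_pos (hv _ (hconj _ _ ht'))).ne
    have hpos := hv _ ht'
    simp only [separating, Set.mem_ofPred_eq, ht, ht', true_and, map_mul, Module.End.mul_apply]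
    rw [inner_map_left_eq hiso g (a t) (ρ h v), inner_map_left_eq hiso g (a t) v]
    have h2 := map_root_eq_or_eq_neg hiso hconj ha g⁻¹ ht
    rw [inv_inv] at h2
    rcases h2 with h1 | h1 <;> rw [h1]
    · have : ¬ ⟪a (g⁻¹ * t * g), v⟫ < 0 := hpos.le.not_gt
      tauto
    · rw [inner_neg_left, inner_neg_left, neg_lt_zero, neg_lt_zero, not_lt]
      simp only [hpos, true_iff]
      exact ⟨le_of_lt, fun h => lt_of_le_of_ne h hne.symm⟩
  · have ht' : g⁻¹ * t * g ∉ R := fun h => ht (by simpa [mul_assoc] using hconj g _ h)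
    simp [separating, ht, ht']

/-- The group is generated by the reflections in the walls of the chamber of `v`. -/
theorem subset_closure_walls (hρ : Function.Injective ρ)
    (hiso : ∀ g x y, ⟪ρ g x, ρ g y⟫ = ⟪x, y⟫)
    (hconj : ∀ g, ∀ t ∈ R, g * t * g⁻¹ ∈ R) (ha : ∀ t ∈ R, IsReflectionAlong (ρ t) (a t))
    (hfin : R.Finite) {v : V} (hv : ∀ t ∈ R, 0 < ⟪a t, v⟫) :
    R ⊆ Subgroup.closure {s ∈ R | separating ρ R a v s = {s}} := by
  set H := Subgroup.closure {s ∈ R | separating ρ R a v s = {s}} with hH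
  by_contra hsub
  -- Among reflections outside `H`, take one whose hyperplane is nearest to `v`.
  obtain ⟨t, ⟨ht, htH⟩, hmin⟩ := Set.exists_min_image (R \ H) (fun t => ⟪a t, v⟫)
    (hfin.subset Set.sdiff_subset) (Set.sdiff_nonempty.2 hsub)
  have hsmall : ∀ r ∈ R, ⟪a r, v⟫ < ⟪a t, v⟫ → r ∈ H := fun r hr hlt => by
    by_contra hrH
    exact (hmin r ⟨hr, hrH⟩).not_gt hlt
  have hvt := hv t ht
  have hat := ha t ht
  -- Under this bound both `r` and `r * t * r⁻¹` have hyperplanes nearer to `v` than `t`, hence lie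
  -- in `H`, and so does `t`.
  have key : ∀ r ∈ R, r ≠ t → 2 * ⟪a r, v⟫ ≤ 2 * ⟪a t, a r⟫ * ⟪a t, v⟫ → False := by
    intro r hr hrt hle
    have hvr := hv r hr
    have hc2 : ⟪a t, a r⟫ < 1 := by
      rw [inner_lt_one_iff_real_of_norm_eq_one hat.1 (ha r hr).1]
      intro h
      have h' := ha r hr
      rw [← h] at h'
      exact hrt (hρ (h'.eq_of_eq hat))
    have hc0 : 0 < ⟪a t, a r⟫ := by
      by_contra! h
      nlinarith
    have hrH : r ∈ H := hsmall r hr (by nlinarith)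
    have hr' := hconj r t ht
    have hrtH : r * t * r⁻¹ ∈ H := by
      apply hsmall _ hr'
      have e : ⟪ρ r (a t), v⟫ = ⟪a t, v⟫ - 2 * ⟪a t, a r⟫ * ⟪a r, v⟫ := by
        rw [(ha r hr).2, inner_sub_left, inner_smul_left, real_inner_comm (a t) (a r)]
        simp
      rcases map_root_eq_or_eq_neg hiso hconj ha r ht with h | h
      · rw [← h, e]
        have := mul_pos hc0 hvr
        linarith
      · rw [← neg_eq_iff_eq_neg] at h
        rw [← h, inner_neg_left, e]
        have h3 : ⟪a t, a r⟫ * ⟪a r, v⟫ ≤ ⟪a t, a r⟫ * (⟪a t, a r⟫ * ⟪a t, v⟫) :=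
          mul_le_mul_of_nonneg_left (by linarith) hc0.le
        have h4 : ⟪a t, a r⟫ * (⟪a t, a r⟫ * ⟪a t, v⟫) < ⟪a t, v⟫ := by nlinarith
        linarith
    apply htH
    have := H.mul_mem (H.mul_mem (H.inv_mem hrH) hrtH) hrH
    simpa [mul_assoc] using this
  have htt : t ∈ separating ρ R a v t := by
    refine ⟨ht, ?_⟩
    rw [hat.2, inner_sub_right, inner_smul_right, hat.inner_self]
    linarith
  obtain ⟨r, hrN, hrt⟩ : ∃ r ∈ separating ρ R a v t, r ≠ t := by
    by_contra! hcon
    exact htH (Subgroup.subset_closure ⟨ht, Set.eq_singleton_iff_unique_mem.2 ⟨htt, hcon⟩⟩)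
  obtain ⟨hr, hneg⟩ := hrN
  have e : ⟪a r, ρ t v⟫ = ⟪a r, v⟫ - 2 * ⟪a t, a r⟫ * ⟪a t, v⟫ := by
    rw [hat.2, inner_sub_right, inner_smul_right, real_inner_comm (a t) (a r)]
    ring
  rw [e] at hneg
  -- If the bound fails for `r`, it holds for `t * r * t⁻¹`, whose positive root is `-ρ t (a r)`.
  by_cases hle : 2 * ⟪a r, v⟫ ≤ 2 * ⟪a t, a r⟫ * ⟪a t, v⟫
  · exact key r hr hrt hle
  · have hr' := hconj t r hr
    refine key _ hr' (fun h => hrt ?_) ?_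
    · rw [mul_inv_eq_iff_eq_mul] at h
      exact mul_left_cancel h
    · have e2 : ρ t (a r) = a r - (2 * ⟪a t, a r⟫) • a t := hat.2 _
      have e3 : ⟪ρ t (a r), v⟫ = ⟪a r, v⟫ - 2 * ⟪a t, a r⟫ * ⟪a t, v⟫ := by
        rw [e2, inner_sub_left, inner_smul_left]
        simp
      have e4 : ⟪a t, ρ t (a r)⟫ = - ⟪a t, a r⟫ := by
        rw [e2, inner_sub_right, inner_smul_right, hat.inner_self]
        ring
      rcases map_root_eq_or_eq_neg hiso hconj ha t hr with h | h
      · have := hv _ hr'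
        rw [← h, e3] at this
        linarith
      · rw [← neg_eq_iff_eq_neg] at h
        rw [← h, inner_neg_left, inner_neg_right, e3, e4]
        linarith

/-- A finite reflection group acts freely on the orbit of a point on no reflecting hyperplane. -/
theorem eq_one_of_map_eq_self (hρ : Function.Injective ρ)
    (hiso : ∀ g x y, ⟪ρ g x, ρ g y⟫ = ⟪x, y⟫)
    (hconj : ∀ g, ∀ t ∈ R, g * t * g⁻¹ ∈ R) (ha : ∀ t ∈ R, IsReflectionAlong (ρ t) (a t))
    (hfin : R.Finite) (hgen : Subgroup.closure R = ⊤) {v : V} (hv : ∀ t ∈ R, 0 < ⟪a t, v⟫)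
    {g : G} (hg : ρ g v = v) : g = 1 := by
  have hempty : ∀ h, ρ h v = v → separating ρ R a v h = ∅ := fun h hh => by
    refine Set.eq_empty_of_forall_notMem fun t ht => ?_
    have h2 := ht.2
    rw [hh] at h2
    exact (hv t ht.1).not_gt h2
  refine eq_one_of_cocycle_eq_empty (D := {s ∈ R | separating ρ R a v s = {s}})
    (hempty 1 (by simp)) (separating_mul hiso hconj ha hv) (fun s hs => ⟨hs.2, ?_⟩) ?_
    (hempty g hg)
  · apply hρ
    rw [map_mul, (ha s hs.1).mul_self, map_one]
  · have h1 : Subgroup.closure R ≤ _ :=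
      (Subgroup.closure_le _).2 (subset_closure_walls hρ hiso hconj ha hfin hv)
    rw [hgen] at h1
    exact h1 (Subgroup.mem_top g)

/-! ### Fixed spaces and Carter's lemma. -/

/-- The fixed space of a group element. -/
def fixedSpace (ρ : G →* Module.End ℝ V) (g : G) : Submodule ℝ V := LinearMap.ker (ρ g - 1)

theorem mem_fixedSpace {g : G} {x : V} : x ∈ fixedSpace ρ g ↔ ρ g x = x := by
  simp [fixedSpace, sub_eq_zero]

/-- A real vector space is not a finite union of proper subspaces, so otherwise some `v` fixed by
`g` lies on no reflecting hyperplane, and freeness forces `g = 1`. -/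
theorem exists_reflection_fixedSpace_le (hρ : Function.Injective ρ)
    (hiso : ∀ g x y, ⟪ρ g x, ρ g y⟫ = ⟪x, y⟫)
    (hconj : ∀ g, ∀ t ∈ R, g * t * g⁻¹ ∈ R) (ha : ∀ t ∈ R, IsReflectionAlong (ρ t) (a t))
    (hfin : R.Finite) (hgen : Subgroup.closure R = ⊤) {g : G} (hg : g ≠ 1) :
    ∃ t ∈ R, fixedSpace ρ g ≤ fixedSpace ρ t := by
  by_contra! hcon
  obtain ⟨v, hv, hvR⟩ : ∃ v ∈ fixedSpace ρ g, ∀ t ∈ R, v ∉ fixedSpace ρ t := by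
    have := hfin.to_subtype
    by_contra! hcov
    obtain ⟨t, ht⟩ := Subspace.exists_eq_top_of_iUnion_eq_univ
      (p := fun t : R => (fixedSpace ρ (t : G)).comap (fixedSpace ρ g).subtype)
      (Set.eq_univ_of_forall fun x => by
        obtain ⟨t, ht, hx⟩ := hcov x x.2
        exact Set.mem_iUnion.2 ⟨⟨t, ht⟩, hx⟩)
    exact hcon t t.2 (Submodule.comap_subtype_eq_top.1 ht)
  apply hg
  classical
  -- Roots are defined up to sign; choose signs so that `v` is in the positive chamber.
  refine eq_one_of_map_eq_self (a := fun t => if 0 < ⟪a t, v⟫ then a t else - a t) hρ hiso hconj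
    (fun t ht => ?_) hfin hgen (v := v) (fun t ht => ?_) (mem_fixedSpace.1 hv)
  · split_ifs
    exacts [ha t ht, (ha t ht).neg]
  · have h0 : ⟪a t, v⟫ ≠ 0 := fun h =>
      hvR t ht (mem_fixedSpace.2 ((ha t ht).apply_eq_self_iff.2 h))
    split_ifs with h
    · exact h
    · rw [inner_neg_left]
      exact neg_pos.2 (lt_of_le_of_ne (not_lt.1 h) h0)

/-- The image of `ρ g - 1` is the orthogonal complement of the fixed space, so it contains `b`. If
`ρ g x = x + b`, then invariance of the norm makes `t` send `x + b` back to `x`: the vector `x` is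
newly fixed. -/
theorem fixedSpace_lt_fixedSpace_mul [FiniteDimensional ℝ V]
    (hiso : ∀ g x y, ⟪ρ g x, ρ g y⟫ = ⟪x, y⟫) {t g : G} {b : V}
    (hb : IsReflectionAlong (ρ t) b) (hle : fixedSpace ρ g ≤ fixedSpace ρ t) :
    fixedSpace ρ g < fixedSpace ρ (t * g) := by
  have hrange : b ∈ LinearMap.range (ρ g - 1) := by
    rw [← Submodule.orthogonal_orthogonal (LinearMap.range (ρ g - 1)), Submodule.mem_orthogonal]
    intro y hy
    have h1 : ⟪ρ g y - y, y⟫ = 0 := by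
      rw [Submodule.mem_orthogonal] at hy
      exact hy _ ⟨y, by simp⟩
    have h2 : ρ g y = y := by
      rw [inner_sub_left, sub_eq_zero] at h1
      rw [← sub_eq_zero, ← inner_self_eq_zero (𝕜 := ℝ), inner_sub_left, inner_sub_right,
        inner_sub_right, hiso, real_inner_comm (ρ g y) y, h1]
      ring
    rw [real_inner_comm]
    exact hb.apply_eq_self_iff.1 (mem_fixedSpace.1 (hle (mem_fixedSpace.2 h2)))
  obtain ⟨x, hx⟩ := hrange
  have hgx : ρ g x = x + b := by
    rw [← hx]
    simp
  have hinner : 2 * ⟪b, x⟫ = -1 := by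
    have h := hiso g x x
    rw [hgx, inner_add_left, inner_add_right, inner_add_right, hb.inner_self,
      real_inner_comm b x] at h
    linarith
  refine lt_of_le_of_ne (fun y hy => ?_) (fun heq => ?_)
  · rw [mem_fixedSpace, map_mul, Module.End.mul_apply, mem_fixedSpace.1 hy]
    exact mem_fixedSpace.1 (hle hy)
  · have hx' : x ∈ fixedSpace ρ (t * g) := by
      rw [mem_fixedSpace, map_mul, Module.End.mul_apply, hgx, map_add, hb.apply_self, hb.2, hinner]
      module
    rw [← heq, mem_fixedSpace, hgx, add_eq_left] at hx'
    have := hb.1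
    simp [hx'] at this

/-- Carter's lemma, upper bound. -/
theorem exists_list_length_le_codim_fixedSpace [FiniteDimensional ℝ V]
    (hρ : Function.Injective ρ) (hiso : ∀ g x y, ⟪ρ g x, ρ g y⟫ = ⟪x, y⟫)
    (hconj : ∀ g, ∀ t ∈ R, g * t * g⁻¹ ∈ R) (ha : ∀ t ∈ R, IsReflectionAlong (ρ t) (a t))
    (hfin : R.Finite) (hgen : Subgroup.closure R = ⊤) (n : ℕ) (g : G)
    (hn : Module.finrank ℝ V ≤ Module.finrank ℝ (fixedSpace ρ g) + n) :
    ∃ l : List G, (∀ t ∈ l, t ∈ R) ∧ l.prod = g ∧ l.length ≤ n := by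
  induction n generalizing g with
  | zero =>
    refine ⟨[], by simp, ?_, le_rfl⟩
    have htop : fixedSpace ρ g = ⊤ :=
      Submodule.eq_top_of_finrank_eq (le_antisymm (Submodule.finrank_le _) hn)
    apply hρ
    refine LinearMap.ext fun x => ?_
    have : x ∈ fixedSpace ρ g := htop ▸ Submodule.mem_top
    simp [mem_fixedSpace.1 this]
  | succ n ih =>
    by_cases hg : g = 1
    · exact ⟨[], by simp, by simp [hg], by simp⟩
    obtain ⟨t, ht, hle⟩ := exists_reflection_fixedSpace_le hρ hiso hconj ha hfin hgen hg
    have hlt := Submodule.finrank_lt_finrank_of_lt (fixedSpace_lt_fixedSpace_mul hiso (ha t ht) hle)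
    obtain ⟨l, h1, h2, h3⟩ := ih (t * g) (by omega)
    refine ⟨t :: l, List.forall_mem_cons.2 ⟨ht, h1⟩, ?_, by simpa using h3⟩
    have htt : t * t = 1 := hρ (by rw [map_mul, (ha t ht).mul_self, map_one])
    rw [List.prod_cons, h2, ← mul_assoc, htt, one_mul]

/-- Carter's lemma, lower bound. -/
theorem codim_fixedSpace_prod_le_length [FiniteDimensional ℝ V] (l : List G)
    (hl : ∀ t ∈ l, ∃ b, IsReflectionAlong (ρ t) b) :
    Module.finrank ℝ V ≤ Module.finrank ℝ (fixedSpace ρ l.prod) + l.length := by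
  induction l with
  | nil =>
    have h : fixedSpace ρ 1 = ⊤ := by simp [fixedSpace]
    rw [List.prod_nil, h, finrank_top]
    exact Nat.le_add_right _ _
  | cons t l ih =>
    obtain ⟨⟨b, hb⟩, hl⟩ := List.forall_mem_cons.1 hl
    have h0 := ih hl
    have hb0 : (innerSL ℝ b).toLinearMap ≠ 0 := fun h => by
      have h' : ⟪b, b⟫ = 0 := LinearMap.congr_fun h b
      rw [hb.inner_self] at h'
      exact one_ne_zero h'
    have h1 := Module.Dual.finrank_ker_add_one_of_ne_zero hb0
    have h2 := Submodule.finrank_sup_add_finrank_inf_eq (fixedSpace ρ l.prod)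
      (LinearMap.ker (innerSL ℝ b).toLinearMap)
    have h3 := Submodule.finrank_le
      (fixedSpace ρ l.prod ⊔ LinearMap.ker (innerSL ℝ b).toLinearMap)
    have h4 : fixedSpace ρ l.prod ⊓ LinearMap.ker (innerSL ℝ b).toLinearMap ≤
        fixedSpace ρ (t :: l).prod := by
      rintro x ⟨hx, hxb⟩
      rw [mem_fixedSpace, List.prod_cons, map_mul, Module.End.mul_apply, mem_fixedSpace.1 hx]
      exact hb.apply_eq_self_iff.2 (by simpa using hxb)
    have h5 := Submodule.finrank_mono h4
    rw [List.length_cons]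
    omega

end Euclidean

-- Comparing `⟪f b, f x⟫` with `⟪b, x⟫` forces `φ = 2 ⟪b, ·⟫ / ‖b‖²`.
open scoped RealInnerProductSpace in
theorem isReflectionAlong_of_isometry {V : Type*} [NormedAddCommGroup V] [InnerProductSpace ℝ V]
    {f : Module.End ℝ V} (hf : ∀ x y, ⟪f x, f y⟫ = ⟪x, y⟫) {φ : V →ₗ[ℝ] ℝ} {b : V} (hb : b ≠ 0)
    (hφ : φ b = 2) (h : ∀ x, f x = x - φ x • b) : IsReflectionAlong f (‖b‖⁻¹ • b) := by
  have hn : ‖b‖ ≠ 0 := norm_ne_zero_iff.2 hb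
  refine ⟨by rw [norm_smul, norm_inv, norm_norm, inv_mul_cancel₀ hn], fun x => ?_⟩
  have h1 := hf b x
  rw [h b, h x, hφ, show b - (2 : ℝ) • b = -b by module, inner_neg_left, inner_sub_right,
    inner_smul_right, real_inner_self_eq_norm_sq] at h1
  have h2 : φ x = 2 * (‖b‖⁻¹ * ⟪b, x⟫) * ‖b‖⁻¹ := by
    field_simp
    linarith
  rw [h x, inner_smul_left, smul_smul, h2]
  rfl

/-! ### The invariant inner product. -/

namespace CoxeterSystem

variable {B W : Type*} [Group W] {M : CoxeterMatrix B} (cs : CoxeterSystem M W)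

/-- The average over the group of the standard inner product on the geometric representation. -/
noncomputable abbrev geomCore [Fintype B] [Fintype W] : InnerProductSpace.Core ℝ (B →₀ ℝ) where
  inner x y := ∑ g : W, ∑ b : B, cs.geomRep g x b * cs.geomRep g y b
  conj_inner_symm x y := by simp [mul_comm]
  re_inner_nonneg x :=
    Finset.sum_nonneg fun g _ => Finset.sum_nonneg fun b _ => mul_self_nonneg _
  add_left x y z := by simp [add_mul, Finset.sum_add_distrib]
  smul_left x y r := by simp [Finset.mul_sum, mul_assoc]
  definite x hx := by
    have h1 := (Finset.sum_eq_zero_iff_of_nonneg fun g _ =>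
      Finset.sum_nonneg fun b _ => mul_self_nonneg (cs.geomRep g x b)).1 hx 1 (Finset.mem_univ _)
    rw [Finset.sum_eq_zero_iff_of_nonneg fun b _ => mul_self_nonneg _] at h1
    ext b
    simpa using h1 b (Finset.mem_univ b)

theorem geomCore_inner_map [Fintype B] [Fintype W] (g : W) (x y : B →₀ ℝ) :
    cs.geomCore.inner (cs.geomRep g x) (cs.geomRep g y) = cs.geomCore.inner x y := by
  refine Fintype.sum_equiv (Equiv.mulRight g) _ _ fun h => ?_
  simp [map_mul]

end CoxeterSystem

/-! ### Comparison of the two lengths. -/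

theorem lengthWrt_le {G : Type*} [Group G] {X : Set G} {l : List G} (hl : ∀ t ∈ l, t ∈ X) :
    lengthWrt X l.prod ≤ l.length :=
  Nat.sInf_le ⟨l, hl, rfl, rfl⟩

theorem exists_list_length_eq_lengthWrt {G : Type*} [Group G] {X : Set G} {l : List G}
    (hl : ∀ t ∈ l, t ∈ X) :
    ∃ l' : List G, (∀ t ∈ l', t ∈ X) ∧ l'.prod = l.prod ∧ l'.length = lengthWrt X l.prod :=
  Nat.sInf_mem (s := {n : ℕ | ∃ l' : List G, (∀ t ∈ l', t ∈ X) ∧ l'.prod = l.prod ∧ l'.length = n})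
    ⟨_, l, hl, rfl, rfl⟩

theorem mainTheorem7 {B W : Type*} [Group W] [Finite W] {M : CoxeterMatrix B}
    (cs : CoxeterSystem M W) (W' : Subgroup W) (hW' : cs.IsReflectionSubgroup W')
    (w : W) (hw : w ∈ W') :
    lengthWrt cs.reflections w = lengthWrt ((W' : Set W) ∩ cs.reflections) w := by
  have : Finite B := Finite.of_injective cs.simple cs.simple_injective
  have := Fintype.ofFinite B
  have := Fintype.ofFinite W
  obtain ⟨l, hl, hlw⟩ := cs.exists_list_of_mem_reflectionSubgroup hW' hw
  subst hlw
  obtain ⟨l₁, hl₁, hp₁, hn₁⟩ := exists_list_length_eq_lengthWrt hl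
  obtain ⟨l₂, hl₂, hp₂, hn₂⟩ := exists_list_length_eq_lengthWrt fun t ht => (hl t ht).2
  refine le_antisymm ?_ ?_
  · rw [← hn₁, ← hp₁]
    exact lengthWrt_le fun t ht => (hl₁ t ht).2
  let _ : NormedAddCommGroup (B →₀ ℝ) := cs.geomCore.toNormedAddCommGroup
  let _ : InnerProductSpace ℝ (B →₀ ℝ) := InnerProductSpace.ofCore cs.geomCore.toCore
  have hiso : ∀ (g : W) (x y : B →₀ ℝ),
      inner ℝ (cs.geomRep g x) (cs.geomRep g y) = inner ℝ x y := cs.geomCore_inner_map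
  have hrefl : ∀ t ∈ cs.reflections, ∃ b, IsReflectionAlong (cs.geomRep t) b := by
    rintro _ ⟨u, i, rfl⟩
    refine ⟨_, IsReflectionAlong.conj hiso (isReflectionAlong_of_isometry (hiso _)
      (φ := M.geomCoroot i) (b := Finsupp.single i 1) (by simp) ?_ fun x => ?_) u⟩
    · rw [M.geomCoroot_single_self, mul_one]
    · rw [cs.geomRep_simple, M.geomReflection_apply]
  choose! a ha using hrefl
  set R : Set W' := {t | (t : W) ∈ cs.reflections} with hR
  have hgen : Subgroup.closure R = ⊤ := by
    refine (Subgroup.eq_top_iff' _).2 fun g => ?_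
    obtain ⟨m, hm, hmg⟩ := cs.exists_list_of_mem_reflectionSubgroup hW' g.2
    lift m to List W' using fun t ht => (hm t ht).1
    have : m.prod = g := by
      apply Subtype.ext
      rw [← hmg, ← Subgroup.val_list_prod]
    rw [← this]
    refine Subgroup.list_prod_mem _ fun t ht => Subgroup.subset_closure ?_
    exact (hm t (List.mem_map_of_mem ht)).2
  have hlow := codim_fixedSpace_prod_le_length (ρ := cs.geomRep) l₂
    fun t ht => ⟨_, ha t (hl₂ t ht)⟩
  -- Restricting the representation to `W'` leaves the fixed space unchanged, so the lower bound
  -- from `l₂` is the very hypothesis of the upper bound in `W'`.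
  obtain ⟨m, hmR, hmp, hml⟩ := exists_list_length_le_codim_fixedSpace
    (ρ := cs.geomRep.comp W'.subtype) (R := R) (a := fun t => a t)
    (cs.geomRep_injective.comp W'.subtype_injective) (fun g => hiso g)
    (fun g t ht => CoxeterSystem.IsReflection.conj ht (g : W)) (fun t ht => ha t ht)
    (Set.toFinite _) hgen l₂.length ⟨l₂.prod, hp₂ ▸ hw⟩ hlow
  rw [← hn₂]
  refine le_trans ?_ hml
  have hmp' : (m.map Subtype.val).prod = l.prod := by
    rw [← hp₂, ← Subgroup.val_list_prod, hmp]
  rw [← hmp', ← List.length_map (f := Subtype.val) (as := m)]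
  refine lengthWrt_le fun t ht => ?_
  obtain ⟨u, hu, rfl⟩ := List.mem_map.1 ht
  exact ⟨u.2, hmR u hu⟩
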